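/- Let $R$ be a commutative ring and let $X=(x_{i,j})$ be a matrix with entries in $R$. For a sequence $A=(a_1,\dots,a_k)$ of row indices and a sequence $B=(b_1,\dots,b_l)$ of column indices of $X$, write $X\begin{pmatrix}A\\B\end{pmatrix}=(x_{a_s,b_t})_{1\le s\le k,\,1\le t\le l}$; let $\sqcup$ denote concatenation of sequences, and for a sequence $J=(j_1,\dots,j_q)$ let $J\setminus(j_\beta)$ denote the sequence of length $q-1$ obtained from $J$ by removing its $\beta$-th entry. The determinant of the $0 \times 0$ matrix is $1$, and the zeroth power of any element of $R$ is $1$. Let $p,q,r\ge 0$ be integers with $p+q\ge 1$, and let $I=(i_1,\dots,i_p)$, $J=(j_1,\dots,j_q)$, $K$ (resp. $I'=(i'_1,\dots,i'_p)$, $J'=(j'_1,\dots,j'_q)$, $K'$) be sequences of row (resp. column) indices of $X$ of lengths $p$, $q$, $r$. Define a $(p+q)\times(p+q)$ matrix $\tilde X=(\tilde x_{\alpha,\beta})_{1\le\alpha,\beta\le p+q}$ by $$ \begin{cases} \tilde x_{\alpha,\beta}=\det X\begin{pmatrix}(i_\alpha)\sqcup J\sqcup K\\(i'_\beta)\sqcup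 J'\sqcup K'\end{pmatrix} & \text{if } 1\le\alpha,\beta\le p,\\ \tilde x_{\alpha,p+\beta}=\det X\begin{pmatrix}(i_\alpha)\sqcup(J\setminus(j_\beta))\sqcup K\\J'\sqcup K'\end{pmatrix} & \text{if } 1\le\alpha\le p,\ 1\le\beta\le q,\\ \tilde x_{p+\alpha,\beta}=\det X\begin{pmatrix}J\sqcup K\\(i'_\beta)\sqcup(J'\setminus(j'_\alpha))\sqcup K'\end{pmatrix} & \text{if } 1\le\alpha\le q,\ 1\le\beta\le p,\\ \tilde x_{p+\alpha,p+\beta}=-\det X\begin{pmatrix}(J\setminus(j_\beta))\sqcup K\\(J'\setminus(j'_\alpha))\sqcup K'\end{pmatrix} & \text{if } 1\le\alpha,\beta\le q. \end{cases} $$ Then $$ \det\tilde X=(-1)^q\,\det X\begin{pmatrix}I\sqcup K\\I'\sqcup K'\end{pmatrix}\cdot\left(\det X\begin{pmatrix}J\sqcup K\\J'\sqcup K'\end{pmatrix}\right)^{p+q-1}. $$ -/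

import Mathlib

universe u v w

section
variable {R : Type u} {m : Type v} {n : Type w}

/-- The `a × b` matrix with rows picked by the sequence `A` of row indices of `X` and columns
picked by the sequence `B` of column indices of `X` (in the given orders, repetitions allowed). -/
def pickMatrix {a b : ℕ} (X : Matrix m n R) (A : Vector m a) (B : Vector n b) :
    Matrix (Fin a) (Fin b) R :=
  Matrix.of fun s t => X A[s] B[t]

/-- The determinant of `pickMatrix X A B`, for sequences `A` and `B` whose lengths are equal
(the lengths may be written differently, hence the explicit proof `h`). -/
def minorDet [CommRing R] {a b : ℕ} (X : Matrix m n R) (A : Vector m a) (B : Vector n b)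
    (h : a = b) : R :=
  ((pickMatrix X A B).submatrix id (Fin.cast h)).det

/-- The `(p+q) × (p+q)` block matrix of minors. `++` is concatenation of sequences, and
`J.eraseIdx β` is `J` with its entry in position `β` removed. -/
def sylvesterMatrix [CommRing R] {p q r : ℕ} (X : Matrix m n R)
    (I : Vector m p) (J : Vector m q) (K : Vector m r)
    (I' : Vector n p) (J' : Vector n q) (K' : Vector n r) :
    Matrix (Fin p ⊕ Fin q) (Fin p ⊕ Fin q) R :=
  Matrix.fromBlocks
    (Matrix.of fun (α : Fin p) (β : Fin p) =>
      minorDet X (#v[I[α]] ++ J ++ K) (#v[I'[β]] ++ J' ++ K') rfl)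
    (Matrix.of fun (α : Fin p) (β : Fin q) =>
      minorDet X (#v[I[α]] ++ J.eraseIdx β β.isLt ++ K) (J' ++ K')
        (by have := β.isLt; omega))
    (Matrix.of fun (α : Fin q) (β : Fin p) =>
      minorDet X (J ++ K) (#v[I'[β]] ++ J'.eraseIdx α α.isLt ++ K')
        (by have := α.isLt; omega))
    (Matrix.of fun (α : Fin q) (β : Fin q) =>
      -minorDet X (J.eraseIdx β β.isLt ++ K) (J'.eraseIdx α α.isLt ++ K') rfl)

end

open Matrix Polynomial

/-! ### Schur complements with the adjugate in place of the inverse -/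

section SchurAdjugate

variable {R : Type*} [CommRing R] {N P : Type*} [Fintype N] [DecidableEq N]
  [Fintype P] [DecidableEq P]

/-! Let `M` be the submatrix on `J ⊔ K`, `J' ⊔ K'`. Cofactor expansion expresses every entry of the
block matrix through `M.adjugate`; up to signs `(-1) ^ β` on the last `q` rows and columns, the
matrix is `M.det • W - U * M.adjugate * V`, where `V` and `U` border `M` by entries of `X` and by
`q` negated unit vectors (`sylvesterMatrix_eq`). The fraction-free Schur formula
`det_smul_sub_mul_adjugate_mul` turns its determinant into `M.det ^ (p + q - 1)` times that of the
bordered matrix. There the unit vectors cancel the rows `J` and columns `J'`, leaving `(-1) ^ q`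
times the minor on `I ⊔ K`, `I' ⊔ K'` (`det_bordered_pickMatrix`). -/

theorem det_mul_det_smul_sub_mul_adjugate_mul (M : Matrix N N R) (V : Matrix N P R)
    (U : Matrix P N R) (W : Matrix P P R) :
    M.det * (M.det • W - U * M.adjugate * V).det =
      M.det ^ Fintype.card P * (fromBlocks M V U W).det := by
  have h : fromBlocks 1 0 (-(U * M.adjugate)) (M.det • (1 : Matrix P P R)) *
      fromBlocks M V U W = fromBlocks M V 0 (M.det • W - U * M.adjugate * V) := by
    rw [fromBlocks_multiply]
    congr 1
    · simp
    · simp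
    · simp [Matrix.mul_assoc, adjugate_mul]
    · simp only [Matrix.neg_mul, smul_mul, Matrix.one_mul]
      abel
  have h' := congrArg det h
  rw [det_mul, det_fromBlocks_zero₁₂, det_fromBlocks_zero₂₁] at h'
  simpa using h'.symm

/-- The fraction-free determinant formula for a Schur complement. -/
theorem det_smul_sub_mul_adjugate_mul [Nonempty P] (M : Matrix N N R) (V : Matrix N P R)
    (U : Matrix P N R) (W : Matrix P P R) :
    (M.det • W - U * M.adjugate * V).det =
      M.det ^ (Fintype.card P - 1) * (fromBlocks M V U W).det := by
  -- `M.det` may be a zero divisor, so `M` is deformed to `t + M`: its determinant is monic in `t`,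
  -- hence cancellable, and `t = 0` gives back `M`.
  have key := det_mul_det_smul_sub_mul_adjugate_mul (charmatrix (-M)) (V.map C) (U.map C) (W.map C)
  obtain ⟨k, hk⟩ := Nat.exists_eq_succ_of_ne_zero (Fintype.card_ne_zero (α := P))
  have hreg : IsLeftRegular (charmatrix (-M)).det := (charpoly_monic (-M)).isRegular.left
  rw [hk, pow_succ', mul_assoc] at key
  have key' := congrArg (evalRingHom 0) (hreg key)
  have hM : (charmatrix (-M)).map (evalRingHom 0) = M := by
    ext i j
    by_cases hij : i = j
    · subst hij; simp
    · simp [hij]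
  have hd : evalRingHom 0 (charmatrix (-M)).det = M.det := by
    rw [RingHom.map_det, RingHom.mapMatrix_apply, hM]
  have ha : (charmatrix (-M)).adjugate.map (evalRingHom 0) = M.adjugate := by
    rw [← RingHom.mapMatrix_apply, RingHom.map_adjugate, RingHom.mapMatrix_apply, hM]
  rw [map_mul, map_pow, hd, RingHom.map_det, RingHom.map_det] at key'
  simp only [RingHom.mapMatrix_apply] at key'
  rw [fromBlocks_map, hM] at key'
  rw [hk, Nat.succ_sub_one]
  convert key' using 2
  · ext i j
    have h1 : U * M.adjugate * V =
        (U.map C * (charmatrix (-M)).adjugate * V.map C).map (evalRingHom 0) := by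
      rw [Matrix.map_mul, Matrix.map_mul, ha]
      congr 1
      · congr 1; ext; simp
      · ext; simp
    rw [h1, ← hd]
    simp
  · congr 2 <;> (ext; simp)

/-- The determinant of a bordered matrix with a single bordering row and column. -/
theorem det_fromBlocks_unit (M : Matrix N N R) (V : Matrix N Unit R)
    (U : Matrix Unit N R) (W : Matrix Unit Unit R) :
    (fromBlocks M V U W).det = M.det * W () () - (U * M.adjugate * V) () () := by
  have h := det_smul_sub_mul_adjugate_mul M V U W
  simpa using h.symm

variable {Q : Type*} [Fintype Q] [DecidableEq Q]

theorem det_fromBlocks_neg_one_zero (M : Matrix Q Q R) :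
    (fromBlocks M (-1 : Matrix Q Q R) (-1 : Matrix Q Q R) 0).det = (-1) ^ Fintype.card Q := by
  have h : fromBlocks M (-1 : Matrix Q Q R) (-1 : Matrix Q Q R) 0 * fromBlocks 1 0 (M - 1) 1 =
      fromBlocks (1 : Matrix Q Q R) (-1) (-1) 0 := by
    simp [fromBlocks_multiply]
  have h' := congrArg det h
  rw [det_mul, det_fromBlocks_zero₁₂, det_fromBlocks_one₁₁] at h'
  simpa [det_neg] using h'

/-- Bordering by minus the identity deletes the corresponding rows and columns, up to sign. -/
theorem det_fromBlocks_fromBlocks_neg_one_zero (M : Matrix Q Q R) (B : Matrix Q P R)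
    (C : Matrix P Q R) (D : Matrix P P R) :
    (fromBlocks (fromBlocks M (-1 : Matrix Q Q R) (-1 : Matrix Q Q R) 0) (fromRows B 0) (fromCols C 0) D).det =
      (-1) ^ Fintype.card Q * D.det := by
  have hY : fromBlocks M (-1 : Matrix Q Q R) (-1 : Matrix Q Q R) 0 * fromBlocks 0 (-1) (-1) (-M) = 1 := by
    simp [fromBlocks_multiply]
  let _ : Invertible (fromBlocks M (-1 : Matrix Q Q R) (-1 : Matrix Q Q R) 0) :=
    ⟨_, mul_eq_one_comm.mp hY, hY⟩
  rw [det_fromBlocks₁₁, det_fromBlocks_neg_one_zero]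
  -- The nonzero parts of the borders meet only the upper left block of the inverse, which is zero.
  have h0 : fromCols C (0 : Matrix P Q R) * ⅟(fromBlocks M (-1 : Matrix Q Q R) (-1 : Matrix Q Q R) 0) *
      fromRows B (0 : Matrix Q P R) = 0 := by
    change fromCols C (0 : Matrix P Q R) * fromBlocks 0 (-1) (-1) (-M) *
      fromRows B (0 : Matrix Q P R) = 0
    rw [← fromRows_fromCols_eq_fromBlocks, fromCols_mul_fromRows]
    simp [fromCols_mul_fromRows]
  rw [h0, sub_zero]

end SchurAdjugate

/-! ### Minors with entries added or removed, in terms of the adjugate -/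

section MinorDet

variable {R : Type*} [CommRing R] {m n : Type*}

theorem det_cons_succAbove {N : ℕ} (X : Matrix m n R) (a : Fin (N + 1) → m)
    (b : Fin (N + 1) → n) (β : Fin (N + 1)) (i : m) :
    (Matrix.of fun s t => X (Fin.cons (α := fun _ => m) i (a ∘ β.succAbove) s) (b t)).det =
      (-1) ^ (β : ℕ) * ∑ j, X i (b j) * (X.submatrix a b).adjugate j β := by
  rw [det_succ_row_zero, Finset.mul_sum]
  refine Finset.sum_congr rfl fun j _ => ?_
  rw [adjugate_fin_succ_eq_det_submatrix]
  have h : ((-1 : R) ^ (β : ℕ)) * (-1) ^ (β : ℕ) = 1 := by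
    rw [← mul_pow]; simp
  simp only [of_apply, Fin.cons_zero]
  rw [pow_add]
  have : ((Matrix.of fun s t => X (Fin.cons (α := fun _ => m) i (a ∘ β.succAbove) s) (b t)).submatrix
      Fin.succ j.succAbove) = (X.submatrix a b).submatrix β.succAbove j.succAbove := by
    ext s t; simp
  rw [this]
  linear_combination (-(-1) ^ (j : ℕ) * X i (b j) *
    ((X.submatrix a b).submatrix β.succAbove j.succAbove).det) * h

/-- Laplace expansion along the new first row, whose cofactors are, up to sign, those of the deleted
row `β`. `A` is described entrywise so that concatenations whose lengths are written differently all
fit. -/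
theorem minorDet_cons_erase_left {L c : ℕ} (X : Matrix m n R) (a : Vector m L) (b : Vector n L)
    (β : Fin L) (i : m) (A : Vector m c) (h : c = L) (hA₀ : ∀ h₀ : 0 < c, A[0] = i)
    (hA : ∀ k (hk : k + 1 < c), A[k + 1] = if k < β then a[k] else a[k + 1]) :
    minorDet X A b h =
      (-1) ^ (β : ℕ) * ∑ j : Fin L, X i b[j] * (pickMatrix X a b).adjugate j β := by
  obtain ⟨N, rfl⟩ : ∃ N, L = N + 1 := ⟨L - 1, by have := β.isLt; omega⟩
  subst h
  refine Eq.trans ?_ (det_cons_succAbove X (fun s => a[s]) (fun t => b[t]) β i)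
  rw [minorDet]
  congr 1
  ext s t
  simp only [submatrix_apply, pickMatrix, of_apply]
  congr 1
  refine Fin.cases ?_ (fun k => ?_) s
  · simpa using hA₀ (Nat.succ_pos N)
  · have := hA k (by omega)
    simp only [Fin.cons_succ, Function.comp, id, Fin.succAbove, Fin.getElem_fin, Fin.val_succ,
      this, Fin.lt_def, Fin.val_castSucc]
    split_ifs <;> simp_all

theorem minorDet_transpose {c d : ℕ} (X : Matrix m n R) (A : Vector m c) (B : Vector n d)
    (h : c = d) : minorDet X A B h = minorDet Xᵀ B A h.symm := by
  subst h
  rw [minorDet, ← det_transpose]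
  rfl

theorem minorDet_cons_erase_right {L c : ℕ} (X : Matrix m n R) (a : Vector m L) (b : Vector n L)
    (β : Fin L) (i : n) (B : Vector n c) (h : L = c) (hB₀ : ∀ h₀ : 0 < c, B[0] = i)
    (hB : ∀ k (hk : k + 1 < c), B[k + 1] = if k < β then b[k] else b[k + 1]) :
    minorDet X a B h =
      (-1) ^ (β : ℕ) * ∑ j : Fin L, (pickMatrix X a b).adjugate β j * X a[j] i := by
  rw [minorDet_transpose, minorDet_cons_erase_left Xᵀ b a β i B h.symm hB₀ hB]
  have : pickMatrix Xᵀ b a = (pickMatrix X a b)ᵀ := rfl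
  simp [this, ← adjugate_transpose, mul_comm]

theorem minorDet_erase_erase {L c d : ℕ} (X : Matrix m n R) (a : Vector m L) (b : Vector n L)
    (α β : Fin L) (A : Vector m c) (B : Vector n d) (h : c = d) (hc : c + 1 = L)
    (hA : ∀ k (hk : k < c), A[k] = if k < β then a[k] else a[k + 1])
    (hB : ∀ k (hk : k < d), B[k] = if k < α then b[k] else b[k + 1]) :
    minorDet X A B h = (-1) ^ (α : ℕ) * (-1) ^ (β : ℕ) * (pickMatrix X a b).adjugate α β := by
  subst hc
  subst h
  rw [adjugate_fin_succ_eq_det_submatrix, pow_add]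
  have h1 : ((-1 : R) ^ (β : ℕ)) * (-1) ^ (β : ℕ) = 1 := by
    rw [← mul_pow]; simp
  have h2 : ((-1 : R) ^ (α : ℕ)) * (-1) ^ (α : ℕ) = 1 := by
    rw [← mul_pow]; simp
  have h3 : minorDet X A B rfl =
      ((pickMatrix X a b).submatrix β.succAbove α.succAbove).det := by
    rw [minorDet]
    congr 1
    ext s t
    have hs := hA s s.isLt
    have ht := hB t t.isLt
    simp only [submatrix_apply, pickMatrix, of_apply, id, Fin.cast_eq_self, Fin.getElem_fin, hs,
      ht, Fin.succAbove, Fin.lt_def, Fin.val_castSucc]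
    congr 1 <;> split_ifs <;> simp_all
  rw [h3]
  linear_combination (-((pickMatrix X a b).submatrix β.succAbove α.succAbove).det) * h1 -
    ((pickMatrix X a b).submatrix β.succAbove α.succAbove).det * (-1) ^ (β : ℕ) *
      (-1) ^ (β : ℕ) * h2

theorem minorDet_cons_cons {L c d : ℕ} (X : Matrix m n R) (a : Vector m L) (b : Vector n L)
    (i : m) (i' : n) (A : Vector m c) (B : Vector n d) (h : c = d) (hc : c = L + 1)
    (hA₀ : ∀ h₀ : 0 < c, A[0] = i) (hA : ∀ k (hk : k + 1 < c), A[k + 1] = a[k])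
    (hB₀ : ∀ h₀ : 0 < d, B[0] = i') (hB : ∀ k (hk : k + 1 < d), B[k + 1] = b[k]) :
    minorDet X A B h = (pickMatrix X a b).det * X i i' -
      ∑ k : Fin L, (∑ j : Fin L, X i b[j] * (pickMatrix X a b).adjugate j k) * X a[k] i' := by
  subst h
  subst hc
  refine Eq.trans ?_ (det_fromBlocks_unit (pickMatrix X a b) (Matrix.of fun k _ => X a[k] i')
    (Matrix.of fun _ j => X i b[j]) (Matrix.of fun _ _ => X i i'))
  -- The new row and column move from first to last place by one common reindexing, so no sign
  -- appears.
  rw [minorDet, ← det_submatrix_equiv_self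
    ((Equiv.optionEquivSumPUnit (Fin L)).symm.trans (finSuccEquiv L).symm)]
  congr 1
  ext s t
  have := hA₀ (Nat.succ_pos L)
  have := hB₀ (Nat.succ_pos L)
  rcases s with s | s <;> rcases t with t | t <;>
    simp_all [pickMatrix]

/-- Negated unit vectors select rows and columns of the adjugate: one factor `-1` cancels the minus
of the Schur complement in the mixed blocks, while two leave `-adjugate` in the last block. -/
theorem sylvesterMatrix_eq {p q r : ℕ} (X : Matrix m n R)
    (I : Vector m p) (J : Vector m q) (K : Vector m r)
    (I' : Vector n p) (J' : Vector n q) (K' : Vector n r) :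
    sylvesterMatrix X I J K I' J' K' =
      fromBlocks 1 0 0 (diagonal fun β : Fin q => (-1) ^ (β : ℕ)) *
      ((pickMatrix X (J ++ K) (J' ++ K')).det • fromBlocks (pickMatrix X I I') 0 0 0 -
        fromRows (pickMatrix X I (J' ++ K')) (-(1 : Matrix (Fin (q + r)) (Fin (q + r)) R).submatrix (Fin.castAdd r) id) *
        (pickMatrix X (J ++ K) (J' ++ K')).adjugate *
        fromCols (pickMatrix X (J ++ K) I') (-(1 : Matrix (Fin (q + r)) (Fin (q + r)) R).submatrix id (Fin.castAdd r))) *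
      fromBlocks 1 0 0 (diagonal fun β : Fin q => (-1) ^ (β : ℕ)) := by
  set M := pickMatrix X (J ++ K) (J' ++ K') with hM
  rw [fromRows_mul, fromRows_mul_fromCols, fromBlocks_smul, sub_eq_add_neg, fromBlocks_neg,
    fromBlocks_add, fromBlocks_multiply, fromBlocks_multiply, sylvesterMatrix]
  have hl : ∀ {a : ℕ} (Z : Matrix (Fin (q + r)) (Fin a) R),
      (1 : Matrix (Fin (q + r)) (Fin (q + r)) R).submatrix (Fin.castAdd r) id * Z =
        Z.submatrix (Fin.castAdd r) id := by
    intro a Z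
    ext s t
    simp [mul_apply, one_apply]
  have hr : ∀ {a : ℕ} (Z : Matrix (Fin a) (Fin (q + r)) R),
      Z * (1 : Matrix (Fin (q + r)) (Fin (q + r)) R).submatrix id (Fin.castAdd r) =
        Z.submatrix id (Fin.castAdd r) := by
    intro a Z
    ext s t
    simp [mul_apply, one_apply]
  congr 1
  · ext α β
    simp only [of_apply]
    rw [minorDet_cons_cons X (J ++ K) (J' ++ K') I[α] I'[β] _ _ _ (by omega)]
    · simp [mul_apply, pickMatrix, sub_eq_add_neg, hM]
    all_goals
      intros
      simp only [Vector.getElem_append]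
      first | (simp; done) | grind
  · ext α β
    have := β.isLt
    simp only [of_apply]
    rw [minorDet_cons_erase_left X (J ++ K) (J' ++ K') (β.castAdd r) I[α]]
    · simp [hr]
      simp [mul_apply, pickMatrix, hM, mul_comm]
    all_goals
      intros
      simp only [Vector.getElem_append, Vector.getElem_eraseIdx, Fin.val_castAdd]
      first | (simp; done) | grind
  · ext α β
    have := α.isLt
    simp only [of_apply]
    rw [minorDet_cons_erase_right X (J ++ K) (J' ++ K') (α.castAdd r) I'[β]]
    · simp [hl]
      simp [mul_apply, pickMatrix, hM]
    all_goals
      intros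
      simp only [Vector.getElem_append, Vector.getElem_eraseIdx, Fin.val_castAdd]
      first | (simp; done) | grind
  · ext α β
    have := α.isLt
    have := β.isLt
    simp only [of_apply]
    rw [minorDet_erase_erase X (J ++ K) (J' ++ K') (α.castAdd r) (β.castAdd r) _ _ _ (by omega)]
    · simp [hl, hr]
      ring
    all_goals
      intros
      simp only [Vector.getElem_append, Vector.getElem_eraseIdx, Fin.val_castAdd]
      grind

theorem det_bordered_pickMatrix {p q r : ℕ} (X : Matrix m n R)
    (I : Vector m p) (J : Vector m q) (K : Vector m r)
    (I' : Vector n p) (J' : Vector n q) (K' : Vector n r) :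
    (fromBlocks (pickMatrix X (J ++ K) (J' ++ K'))
      (fromCols (pickMatrix X (J ++ K) I') (-(1 : Matrix (Fin (q + r)) (Fin (q + r)) R).submatrix id (Fin.castAdd r)))
      (fromRows (pickMatrix X I (J' ++ K')) (-(1 : Matrix (Fin (q + r)) (Fin (q + r)) R).submatrix (Fin.castAdd r) id))
      (fromBlocks (pickMatrix X I I') 0 0 0)).det =
      (-1) ^ q * minorDet X (I ++ K) (I' ++ K') rfl := by
  -- Groups the `J` part of `M` with the `q` unit borders, and `I` with `K`. Rows and columns are
  -- permuted alike, so the determinant is unchanged.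
  let e : (Fin q ⊕ Fin q) ⊕ (Fin p ⊕ Fin r) ≃ Fin (q + r) ⊕ (Fin p ⊕ Fin q) :=
    { toFun := Sum.elim (Sum.elim (fun a => .inl (a.castAdd r)) (fun a => .inr (.inr a)))
        (Sum.elim (fun a => .inr (.inl a)) (fun a => .inl (a.natAdd q)))
      invFun := Sum.elim (fun a => Fin.addCases (fun a => .inl (.inl a)) (fun a => .inr (.inr a)) a)
        (Sum.elim (fun a => .inr (.inl a)) (fun a => .inl (.inr a)))
      left_inv := by rintro ((a | a) | (a | a)) <;> simp
      right_inv := by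
        rintro (a | (a | a))
        · refine Fin.addCases (fun a => ?_) (fun a => ?_) a <;> simp
        · simp
        · simp }
  have key := det_fromBlocks_fromBlocks_neg_one_zero (pickMatrix X J J')
    (fromCols (pickMatrix X J I') (pickMatrix X J K'))
    (fromRows (pickMatrix X I J') (pickMatrix X K J'))
    ((pickMatrix X (I ++ K) (I' ++ K')).submatrix finSumFinEquiv finSumFinEquiv)
  rw [Fintype.card_fin, det_submatrix_equiv_self] at key
  rw [← det_submatrix_equiv_self e]
  refine Eq.trans (congrArg det ?_) key
  ext s t
  rcases s with (s | s) | (s | s) <;> rcases t with (t | t) | (t | t) <;>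
    simp [e, pickMatrix, one_apply]
  all_goals
    intro h
    have := congrArg Fin.val h
    simp only [Fin.val_castAdd, Fin.val_natAdd] at this
    omega

end MinorDet

theorem theorem1p3 {R : Type u} [CommRing R] {m : Type v} {n : Type w} (X : Matrix m n R)
    (p q r : ℕ) (hpq : 1 ≤ p + q)
    (I : Vector m p) (J : Vector m q) (K : Vector m r)
    (I' : Vector n p) (J' : Vector n q) (K' : Vector n r) :
    (sylvesterMatrix X I J K I' J' K').det =
      (-1) ^ q * minorDet X (I ++ K) (I' ++ K') rfl *
        minorDet X (J ++ K) (J' ++ K') rfl ^ (p + q - 1) := by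
  have : Nonempty (Fin p ⊕ Fin q) := by
    rw [← Fintype.card_pos_iff]
    rw [Fintype.card_sum, Fintype.card_fin, Fintype.card_fin]
    exact hpq
  -- The sign matrices on the two sides have the same determinant, whose square is one.
  have hs : (∏ β : Fin q, (-1 : R) ^ (β : ℕ)) * ∏ β : Fin q, (-1 : R) ^ (β : ℕ) = 1 := by
    rw [← Finset.prod_mul_distrib]
    refine Finset.prod_eq_one fun β _ => ?_
    rw [← mul_pow]; simp
  have hJ : (pickMatrix X (J ++ K) (J' ++ K')).det = minorDet X (J ++ K) (J' ++ K') rfl := rfl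
  rw [sylvesterMatrix_eq, det_mul, det_mul, det_fromBlocks_zero₁₂, det_one, one_mul, det_diagonal,
    mul_right_comm, hs, one_mul, det_smul_sub_mul_adjugate_mul, det_bordered_pickMatrix, hJ,
    Fintype.card_sum, Fintype.card_fin, Fintype.card_fin, mul_comm]
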